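/- A transmitter with $N_t$ antennas and power budget $P$ serves $K=2$ single-antenna receivers with channels $\mathbf h_1,\mathbf h_2\in\mathbb C^{1\times N_t}$; receiver 2 is the only unauthorized receiver. Let $\tau_{ms}>0$ be the required multicast rate and $\tau'=2^{\tau_{ms}}-1$. Let $\mathbf Q_0,\mathbf Q_a,\mathbf Q_c\in\mathbb C^{N_t\times N_t}$ be the covariances of the multicast message, the artificial noise and the confidential message, and consider the secrecy rate maximization problem $$g^*=\max_{\mathbf Q_0,\mathbf Q_a,\mathbf Q_c,\;\alpha\ge 1}\ \log_2\frac{1+\mathbf h_1(\mathbf Q_c+\mathbf Q_a)\mathbf h_1^H}{\alpha(1+\mathbf h_1\mathbf Q_a\mathbf h_1^H)}$$ subject to $$\log_2\Big(1+\frac{\mathbf h_2\mathbf Q_c\mathbf h_2^H}{1+\mathbf h_2\mathbf Q_a\mathbf h_2^H}\Big)\le\log_2\alpha,\qquad \mathbf h_k\mathbf Q_0\mathbf h_k^H-\tau'\mathbf h_k(\mathbf Q_a+\mathbf Q_c)\mathbf h_k^H-\tau'\ge 0\ (k=1,2),$$ $$\mathrm{Tr}(\mathbf Q_0+\mathbf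 Q_a+\mathbf Q_c)\le P,\qquad \mathbf Q_0,\mathbf Q_a,\mathbf Q_c\succeq\mathbf 0 .$$ For fixed $\alpha\ge1$, the inner problem at $\alpha$ is to maximize $\frac{1+\mathbf h_1(\mathbf Q_c+\mathbf Q_a)\mathbf h_1^H}{\alpha(1+\mathbf h_1\mathbf Q_a\mathbf h_1^H)}$ over $(\mathbf Q_0,\mathbf Q_a,\mathbf Q_c)$ subject to the same constraints, the first of them in the form $(\alpha-1)(1+\mathbf h_2\mathbf Q_a\mathbf h_2^H)-\mathbf h_2\mathbf Q_c\mathbf h_2^H\ge0$. Then: 1. For every $\alpha\ge 1$ for which the inner problem is feasible, it has an optimal solution with $\mathrm{rank}(\mathbf Q_0^*)=1$ and $\mathrm{rank}(\mathbf Q_a^*)\le1$. If $\mathbf h_1,\mathbf h_2$ are linearly independent, then every optimal solution of the inner problem, for every $\alpha\ge1$, satisfies $\mathrm{rank}(\mathbf Q_a^*)\le 1$, and also $\mathrm{rank}(\mathbf Q_0^*)=1$ provided that $\mathbf h_1\mathbf h_2^H\ne0$. 2. If the secrecy rate maximization problem is feasible, it has an optimal solution with $\mathrm{rank}(\mathbf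 Q_0^*)=1$ and $\mathrm{rank}(\mathbf Q_a^*)\le1$. If moreover its optimal value $g^*$ is positive, then every optimal solution satisfies $\mathrm{rank}(\mathbf Q_a^*)\le 1$, and also $\mathrm{rank}(\mathbf Q_0^*)=1$ provided that $\mathbf h_1\mathbf h_2^H\neq0$. -/

import Mathlib

open scoped ComplexOrder

noncomputable section

namespace ServiceIntegration

/-- The three transmit covariance matrices, for `n` transmit antennas: multicast message,
artificial noise and confidential message. -/
structure Covariances (n : ℕ) where
  Q0 : Matrix (Fin n) (Fin n) ℂ
  Qa : Matrix (Fin n) (Fin n) ℂ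
  Qc : Matrix (Fin n) (Fin n) ℂ

/-- The received power `h Q hᴴ`, for a row vector `h` (a real number when `Q` is Hermitian). -/
def rxPower {n : ℕ} (h : Fin n → ℂ) (Q : Matrix (Fin n) (Fin n) ℂ) : ℝ :=
  (h ⬝ᵥ Q.mulVec (star h)).re

/-- The SINR threshold `2 ^ τ - 1` equivalent to the multicast rate requirement `τ`. -/
def sinrThreshold (τ : ℝ) : ℝ := (2 : ℝ) ^ τ - 1

/-- The constraints that do not involve the slack variable: multicast quality of service at
every receiver, sum power budget, and positive semidefiniteness.  There are `m + 1` receivers;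
receiver `0` orders the confidential service, and the `m` receivers `Fin.succ k` are
unauthorized. -/
structure IsAdmissible {n m : ℕ} (h : Fin (m + 1) → Fin n → ℂ) (P τ : ℝ)
    (Q : Covariances n) : Prop where
  multicast : ∀ k, 0 ≤ rxPower (h k) Q.Q0
    - sinrThreshold τ * rxPower (h k) (Q.Qa + Q.Qc) - sinrThreshold τ
  power : (Q.Q0 + Q.Qa + Q.Qc).trace.re ≤ P
  psd_Q0 : Q.Q0.PosSemidef
  psd_Qa : Q.Qa.PosSemidef
  psd_Qc : Q.Qc.PosSemidef

/-- `x` is a global maximizer of `f` over the set `S`. -/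
def IsOptimal {X : Type*} (S : Set X) (f : X → ℝ) (x : X) : Prop :=
  x ∈ S ∧ ∀ y ∈ S, f y ≤ f x

/-- Feasible set of the secrecy rate maximization problem; a point is a triple of covariances
together with the slack variable `α ≥ 1`. -/
def srmFeasible {n m : ℕ} (h : Fin (m + 1) → Fin n → ℂ) (P τ : ℝ) : Set (Covariances n × ℝ) :=
  {x | IsAdmissible h P τ x.1 ∧ 1 ≤ x.2 ∧
    ∀ k : Fin m, Real.logb 2 (1 + rxPower (h k.succ) x.1.Qc / (1 + rxPower (h k.succ) x.1.Qa))
      ≤ Real.logb 2 x.2}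

/-- Objective of the secrecy rate maximization problem. -/
def srmObjective {n m : ℕ} (h : Fin (m + 1) → Fin n → ℂ) (x : Covariances n × ℝ) : ℝ :=
  Real.logb 2 ((1 + rxPower (h 0) (x.1.Qc + x.1.Qa)) / (x.2 * (1 + rxPower (h 0) x.1.Qa)))

/-- Feasible set of the inner problem, in which `α` is fixed. -/
def innerFeasible {n m : ℕ} (h : Fin (m + 1) → Fin n → ℂ) (P τ α : ℝ) : Set (Covariances n) :=
  {Q | IsAdmissible h P τ Q ∧
    ∀ k : Fin m, 0 ≤ (α - 1) * (1 + rxPower (h k.succ) Q.Qa) - rxPower (h k.succ) Q.Qc}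

/-- Objective of the inner problem, in which `α` is fixed. -/
def innerObjective {n m : ℕ} (h : Fin (m + 1) → Fin n → ℂ) (α : ℝ) (Q : Covariances n) : ℝ :=
  (1 + rxPower (h 0) (Q.Qc + Q.Qa)) / (α * (1 + rxPower (h 0) Q.Qa))

end ServiceIntegration

end

/-! Write a covariance as `Q = Aᴴ * A`: received powers and trace become sums over the rows `a i` of
`|⟨v, a i⟩|²` and `‖a i‖²`. For independent channels, expand the rows in the dual basis `d₁, d₂` of
the channel plane. With both received powers fixed, only the cross term and the component off the
plane affect the energy. Cauchy–Schwarz bounds the cross term, and one vector with the right phase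
attains the bound, so rank one suffices (`exists_rank_le_one`). If the channels are not orthogonal,
then `⟨d₁, d₂⟩ ≠ 0`, and equality of energies forces collinear rows. The noise need only be
dominated at receiver `0`, which covers the orthogonal case too (`exists_dominated`). Existence of a
maximizer is compactness of the set of Gram factors, with `α` eliminated as the least admissible
slack. For every optimum to have low rank, power must be scarce. With independent channels, unspent
power could go into a confidential signal nulled at the eavesdropper, so every optimum exhausts the
budget and a replacement cannot save any (`le_trace_of_isOptimal_inner`). With dependent channels
nulling is impossible. Instead, a positive secrecy rate means receiver `0` has the larger gain, and
turning noise and spare power into confidential signal would strictly help (`degraded_comparison`).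
So the noise reaches nobody, and as the budget is exhausted even without it, it vanishes. -/

noncomputable section

namespace ServiceIntegration

/-! ### Energy of vector families with prescribed functionals -/

section HilbertSpace

variable {E : Type*} [NormedAddCommGroup E] [InnerProductSpace ℂ E]

/-- Gram–Schmidt: the component of `v₁` orthogonal to `v₂`, rescaled. The coefficients are kept to
show that the vector stays in the plane. -/
lemma exists_dual_vector {v₁ v₂ : E} (hv : LinearIndependent ℂ ![v₁, v₂]) :
    ∃ (d : E) (s t : ℂ), d = s • v₁ + t • v₂ ∧ inner ℂ v₁ d = 1 ∧ inner ℂ v₂ d = 0 := by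
  have h2 : v₂ ≠ 0 := hv.ne_zero 1
  have h22 : inner ℂ v₂ v₂ ≠ 0 := inner_self_ne_zero.2 h2
  set c : ℂ := inner ℂ v₂ v₁ / inner ℂ v₂ v₂ with hc
  set z : E := v₁ - c • v₂ with hz
  have hz0 : z ≠ 0 := by
    intro h0
    have := LinearIndependent.pair_iff.1 hv 1 (-c) (by rw [← h0, hz]; module)
    exact one_ne_zero this.1
  have hzz : inner ℂ z z ≠ 0 := inner_self_ne_zero.2 hz0
  have h2z : inner ℂ v₂ z = 0 := by
    rw [hz, inner_sub_right, inner_smul_right, hc, div_mul_cancel₀ _ h22, sub_self]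
  have h1z : inner ℂ v₁ z = inner ℂ z z := by
    have : v₁ = z + c • v₂ := by rw [hz]; module
    nth_rewrite 1 [this]
    rw [inner_add_left, inner_smul_left, h2z, mul_zero, add_zero]
  refine ⟨(inner ℂ z z)⁻¹ • z, (inner ℂ z z)⁻¹, -(inner ℂ z z)⁻¹ * c, ?_, ?_, ?_⟩
  · rw [hz]; module
  · rw [inner_smul_right, h1z, inv_mul_cancel₀ hzz]
  · rw [inner_smul_right, h2z, mul_zero]

/-- A dual basis of the plane spanned by `v₁` and `v₂`, within that plane. -/
lemma exists_dual_basis {v₁ v₂ : E} (hv : LinearIndependent ℂ ![v₁, v₂]) :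
    ∃ d₁ d₂ : E, inner ℂ v₁ d₁ = 1 ∧ inner ℂ v₂ d₁ = 0 ∧ inner ℂ v₁ d₂ = 0 ∧
      inner ℂ v₂ d₂ = 1 ∧
      (∀ x, inner ℂ v₁ x = 0 → inner ℂ v₂ x = 0 → inner ℂ d₁ x = 0 ∧ inner ℂ d₂ x = 0) ∧
      (inner ℂ v₁ v₂ ≠ 0 → inner ℂ d₁ d₂ ≠ 0) := by
  have hv' : LinearIndependent ℂ ![v₂, v₁] := by
    rw [LinearIndependent.pair_iff] at hv ⊢
    intro s t h
    exact (hv t s (by rw [add_comm]; exact h)).symm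
  obtain ⟨d₁, s, t, hd₁, h11, h21⟩ := exists_dual_vector hv
  obtain ⟨d₂, s', t', hd₂, h22, h12⟩ := exists_dual_vector hv'
  refine ⟨d₁, d₂, h11, h21, h12, h22, ?_, ?_⟩
  · intro x h1 h2
    constructor
    · rw [hd₁, inner_add_left, inner_smul_left, inner_smul_left, h1, h2]; simp
    · rw [hd₂, inner_add_left, inner_smul_left, inner_smul_left, h1, h2]; simp
  -- Pairing `d₁` with `d₂` gives the conjugate of `t`. If it vanishes, `d₁` is a nonzero multiple
  -- of `v₁`, and then `⟨v₂, d₁⟩ = 0` makes `v₁, v₂` orthogonal.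
  · intro hne h0
    have ht : t = 0 := by
      rw [hd₁, inner_add_left, inner_smul_left, inner_smul_left, h12, h22] at h0
      simpa using h0
    rw [hd₁, ht, zero_smul, add_zero, inner_smul_right] at h11 h21
    rcases mul_eq_zero.1 h21 with hs | hs
    · rw [hs, zero_mul] at h11; exact zero_ne_one h11
    · exact hne (inner_eq_zero_symm.1 hs)

lemma norm_smul_add_smul_sq (d₁ d₂ : E) (x y : ℂ) :
    ‖x • d₁ + y • d₂‖ ^ 2 = ‖x‖ ^ 2 * ‖d₁‖ ^ 2 + ‖y‖ ^ 2 * ‖d₂‖ ^ 2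
      + 2 * (starRingEnd ℂ x * y * inner ℂ d₁ d₂).re := by
  rw [norm_add_sq (𝕜 := ℂ), norm_smul, norm_smul, inner_smul_left, inner_smul_right, mul_assoc]
  simp only [RCLike.re_to_complex]
  ring

lemma exists_phase (e : ℂ) : ∃ u : ℂ, ‖u‖ = 1 ∧ u * e = -(‖e‖ : ℂ) := by
  by_cases he : e = 0
  · exact ⟨1, by simp, by simp [he]⟩
  · have hn : (‖e‖ : ℂ) ≠ 0 := by simpa using he
    refine ⟨-(‖e‖ : ℂ) / e, ?_, div_mul_cancel₀ _ he⟩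
    rw [norm_div, norm_neg, Complex.norm_real, norm_norm, div_self (by simpa using he)]

variable {ι : Type*} [Fintype ι]

/-- The square-norm decomposition of a finite family along a dual basis. -/
lemma sum_norm_sq_eq {v₁ v₂ d₁ d₂ : E} (h11 : inner ℂ v₁ d₁ = 1) (h21 : inner ℂ v₂ d₁ = 0)
    (h12 : inner ℂ v₁ d₂ = 0) (h22 : inner ℂ v₂ d₂ = 1)
    (hd : ∀ x, inner ℂ v₁ x = 0 → inner ℂ v₂ x = 0 → inner ℂ d₁ x = 0 ∧ inner ℂ d₂ x = 0)
    (a : ι → E) :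
    ∑ i, ‖a i‖ ^ 2 = (∑ i, ‖inner ℂ v₁ (a i)‖ ^ 2) * ‖d₁‖ ^ 2
      + (∑ i, ‖inner ℂ v₂ (a i)‖ ^ 2) * ‖d₂‖ ^ 2
      + 2 * ((∑ i, starRingEnd ℂ (inner ℂ v₁ (a i)) * inner ℂ v₂ (a i)) * inner ℂ d₁ d₂).re
      + ∑ i, ‖a i - (inner ℂ v₁ (a i) • d₁ + inner ℂ v₂ (a i) • d₂)‖ ^ 2 := by
  rw [Finset.sum_mul, Finset.sum_mul, Finset.sum_mul, Complex.re_sum, Finset.mul_sum,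
    ← Finset.sum_add_distrib, ← Finset.sum_add_distrib, ← Finset.sum_add_distrib]
  refine Finset.sum_congr rfl fun i _ => ?_
  rw [← norm_smul_add_smul_sq]
  set x := inner ℂ v₁ (a i) with hx
  set y := inner ℂ v₂ (a i) with hy
  -- The remainder is orthogonal to the plane, so Pythagoras applies.
  obtain ⟨o1, o2⟩ := hd (a i - (x • d₁ + y • d₂))
    (by rw [inner_sub_right, inner_add_right, inner_smul_right, inner_smul_right, h11, h12]
        simp [hx])
    (by rw [inner_sub_right, inner_add_right, inner_smul_right, inner_smul_right, h21, h22]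
        simp [hy])
  have ho : inner ℂ (x • d₁ + y • d₂) (a i - (x • d₁ + y • d₂)) = 0 := by
    rw [inner_add_left, inner_smul_left, inner_smul_left, o1, o2]; simp
  have := norm_add_sq_eq_norm_sq_add_norm_sq_of_inner_eq_zero (𝕜 := ℂ) _ _ ho
  rw [add_sub_cancel] at this
  nlinarith [this]

lemma eq_of_sum_norm_sub_sq_nonpos {F : Type*} [NormedAddCommGroup F] {a b : ι → F} (h : ∑ i, ‖a i - b i‖ ^ 2 ≤ 0) (i : ι) :
    a i = b i := by
  have h0 := le_antisymm h (Finset.sum_nonneg fun i _ => by positivity)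
  have := (Finset.sum_eq_zero_iff_of_nonneg fun i _ => by positivity).1 h0 i (Finset.mem_univ i)
  exact sub_eq_zero.1 (norm_eq_zero.1 (pow_eq_zero_iff two_ne_zero |>.1 this))

/-- Cauchy–Schwarz for finite families of complex numbers. -/
lemma norm_sum_conj_mul_le (x y : ι → ℂ) :
    ‖∑ i, starRingEnd ℂ (x i) * y i‖ ≤ √(∑ i, ‖x i‖ ^ 2) * √(∑ i, ‖y i‖ ^ 2) := by
  have := norm_inner_le_norm (𝕜 := ℂ) (WithLp.toLp 2 x) (WithLp.toLp 2 y)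
  simpa [EuclideanSpace.norm_eq, PiLp.inner_apply, mul_comm] using this

/-- Equality case of Cauchy–Schwarz, with zero families split off because the criterion needs
nonzero vectors. -/
lemma collinear_of_norm_sum_conj_mul_eq {x y : ι → ℂ}
    (h : √(∑ i, ‖x i‖ ^ 2) * √(∑ i, ‖y i‖ ^ 2) ≤ ‖∑ i, starRingEnd ℂ (x i) * y i‖) :
    (∀ i, x i = 0) ∨ ∃ t : ℂ, ∀ i, y i = t * x i := by
  by_cases hx : WithLp.toLp 2 x = 0
  · left; intro i; simpa using congrArg (fun z : EuclideanSpace ℂ ι => z i) hx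
  · right
    by_cases hy : WithLp.toLp 2 y = 0
    · exact ⟨0, fun i => by simpa using congrArg (fun z : EuclideanSpace ℂ ι => z i) hy⟩
    · have h1 := norm_inner_le_norm (𝕜 := ℂ) (WithLp.toLp 2 x) (WithLp.toLp 2 y)
      have h2 : ‖WithLp.toLp 2 x‖ * ‖WithLp.toLp 2 y‖
          ≤ ‖inner ℂ (WithLp.toLp 2 x) (WithLp.toLp 2 y)‖ := by
        simpa [EuclideanSpace.norm_eq, PiLp.inner_apply, mul_comm] using h
      obtain ⟨r, _, hr⟩ := (norm_inner_eq_norm_iff (𝕜 := ℂ) hx hy).1 (le_antisymm h1 h2)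
      exact ⟨r, fun i => by simpa using congrArg (fun z : EuclideanSpace ℂ ι => z i) hr⟩

/-- Two independent functionals of a finite family are matched by a single vector of no larger
energy. -/
lemma exists_single_of_linearIndependent {v₁ v₂ : E} (hv : LinearIndependent ℂ ![v₁, v₂])
    (a : ι → E) :
    ∃ w : E, ‖inner ℂ v₁ w‖ ^ 2 = ∑ i, ‖inner ℂ v₁ (a i)‖ ^ 2 ∧
      ‖inner ℂ v₂ w‖ ^ 2 = ∑ i, ‖inner ℂ v₂ (a i)‖ ^ 2 ∧
      ‖w‖ ^ 2 ≤ ∑ i, ‖a i‖ ^ 2 ∧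
      (inner ℂ v₁ v₂ ≠ 0 → ∑ i, ‖a i‖ ^ 2 ≤ ‖w‖ ^ 2 → ∃ e : E, ∀ i, ∃ c : ℂ, a i = c • e) := by
  obtain ⟨d₁, d₂, h11, h21, h12, h22, hd, hne⟩ := exists_dual_basis hv
  obtain ⟨u, hu, hue⟩ := exists_phase (inner ℂ d₁ d₂)
  have hsum := sum_norm_sq_eq h11 h21 h12 h22 hd a
  set x : ι → ℂ := fun i => inner ℂ v₁ (a i) with hx
  set y : ι → ℂ := fun i => inner ℂ v₂ (a i) with hy
  set p₁ : ℝ := ∑ i, ‖x i‖ ^ 2 with hp₁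
  set p₂ : ℝ := ∑ i, ‖y i‖ ^ 2 with hp₂
  set e := inner ℂ d₁ d₂ with he
  set b : ℂ := ∑ i, starRingEnd ℂ (x i) * y i with hb
  have hp₁0 : 0 ≤ p₁ := Finset.sum_nonneg fun i _ => by positivity
  have hp₂0 : 0 ≤ p₂ := Finset.sum_nonneg fun i _ => by positivity
  have hcs : ‖b‖ ≤ √p₁ * √p₂ := norm_sum_conj_mul_le x y
  have hres : 0 ≤ ∑ i, ‖a i - (x i • d₁ + y i • d₂)‖ ^ 2 :=
    Finset.sum_nonneg fun i _ => by positivity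
  have hbe : -(‖b‖ * ‖e‖) ≤ (b * e).re := by
    rw [← norm_mul]; exact (abs_le.1 (Complex.abs_re_le_norm _)).1
  -- The phase `u` makes the cross term as negative as Cauchy–Schwarz permits for these powers.
  have hw : ‖(√p₁ : ℂ) • d₁ + ((√p₂ : ℂ) * u) • d₂‖ ^ 2
      = p₁ * ‖d₁‖ ^ 2 + p₂ * ‖d₂‖ ^ 2 - 2 * (√p₁ * √p₂ * ‖e‖) := by
    have hre : (starRingEnd ℂ (√p₁ : ℂ) * ((√p₂ : ℂ) * u) * e).re = -(√p₁ * √p₂ * ‖e‖) := by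
      rw [Complex.conj_ofReal, mul_assoc, mul_assoc, hue]
      norm_cast
      ring
    rw [norm_smul_add_smul_sq, hre, norm_mul, hu, Complex.norm_real, Complex.norm_real, mul_one,
      Real.norm_of_nonneg (Real.sqrt_nonneg _), Real.norm_of_nonneg (Real.sqrt_nonneg _),
      Real.sq_sqrt hp₁0, Real.sq_sqrt hp₂0]
    ring
  refine ⟨(√p₁ : ℂ) • d₁ + ((√p₂ : ℂ) * u) • d₂, ?_, ?_, ?_, ?_⟩
  · rw [inner_add_right, inner_smul_right, inner_smul_right, h11, h12, mul_one, mul_zero, add_zero,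
      Complex.norm_real, Real.norm_of_nonneg (Real.sqrt_nonneg _), Real.sq_sqrt hp₁0]
  · rw [inner_add_right, inner_smul_right, inner_smul_right, h21, h22, mul_one, mul_zero, zero_add,
      norm_mul, hu, mul_one,
      Complex.norm_real, Real.norm_of_nonneg (Real.sqrt_nonneg _), Real.sq_sqrt hp₂0]
  · rw [hw, hsum]
    nlinarith [mul_le_mul_of_nonneg_right hcs (norm_nonneg e)]
  · intro h12ne hle
    rw [hw, hsum] at hle
    have he0 : 0 < ‖e‖ := norm_pos_iff.2 (hne h12ne)
    have hmul := mul_le_mul_of_nonneg_right hcs (norm_nonneg e)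
    -- Equal energies make both losses vanish: the off-plane remainder and, since `e ≠ 0`, the
    -- Cauchy–Schwarz gap.
    have hdec := fun i => eq_of_sum_norm_sub_sq_nonpos (a := a)
      (b := fun i => x i • d₁ + y i • d₂) (by linarith) i
    have hcs' : √p₁ * √p₂ ≤ ‖b‖ := le_of_mul_le_mul_right (by linarith) he0
    rcases collinear_of_norm_sum_conj_mul_eq hcs' with h0 | ⟨t, ht⟩
    · exact ⟨d₂, fun i => ⟨y i, by rw [hdec i]; simp only [h0 i, zero_smul, zero_add]⟩⟩
    · exact ⟨d₁ + t • d₂, fun i => ⟨x i, by rw [hdec i]; simp only [ht i]; module⟩⟩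

/-- A single functional of a finite family is matched by a multiple of the representing vector. -/
lemma exists_single_of_ne_zero {v : E} (hv : v ≠ 0) (a : ι → E) :
    ∃ w : E, (∃ r : ℂ, w = r • v) ∧ ‖inner ℂ v w‖ ^ 2 = ∑ i, ‖inner ℂ v (a i)‖ ^ 2 ∧
      ‖w‖ ^ 2 ≤ ∑ i, ‖a i‖ ^ 2 ∧
      (∑ i, ‖a i‖ ^ 2 ≤ ‖w‖ ^ 2 → ∀ i, ∃ c : ℂ, a i = c • v) := by
  have hv' : 0 < ‖v‖ := norm_pos_iff.2 hv
  set p : ℝ := ∑ i, ‖inner ℂ v (a i)‖ ^ 2 with hp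
  have hp0 : 0 ≤ p := Finset.sum_nonneg fun i _ => by positivity
  have hvv : inner ℂ v v = ((‖v‖ : ℂ)) ^ 2 := inner_self_eq_norm_sq_to_K v
  have hvv0 : inner ℂ v v ≠ 0 := inner_self_ne_zero.2 hv
  have hterm : ∀ i, ‖a i‖ ^ 2 = ‖inner ℂ v (a i)‖ ^ 2 / ‖v‖ ^ 2
      + ‖a i - (inner ℂ v (a i) / inner ℂ v v) • v‖ ^ 2 := by
    intro i
    set c := inner ℂ v (a i) / inner ℂ v v with hc
    have ho : inner ℂ (c • v) (a i - c • v) = 0 := by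
      rw [inner_smul_left, inner_sub_right, inner_smul_right, hc, div_mul_cancel₀ _ hvv0, sub_self,
        mul_zero]
    have := norm_add_sq_eq_norm_sq_add_norm_sq_of_inner_eq_zero (𝕜 := ℂ) _ _ ho
    rw [add_sub_cancel] at this
    have hn : ‖c • v‖ ^ 2 = ‖inner ℂ v (a i)‖ ^ 2 / ‖v‖ ^ 2 := by
      rw [norm_smul, hc, norm_div, hvv, norm_pow, Complex.norm_real, norm_norm]
      field_simp
    nlinarith [this]
  have hsum : ∑ i, ‖a i‖ ^ 2 = p / ‖v‖ ^ 2
      + ∑ i, ‖a i - (inner ℂ v (a i) / inner ℂ v v) • v‖ ^ 2 := by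
    rw [hp, Finset.sum_div, ← Finset.sum_add_distrib]
    exact Finset.sum_congr rfl fun i _ => hterm i
  have hw : ‖((√p / ‖v‖ ^ 2 : ℝ) : ℂ) • v‖ ^ 2 = p / ‖v‖ ^ 2 := by
    rw [norm_smul, Complex.norm_real, Real.norm_of_nonneg (by positivity), mul_pow, div_pow,
      Real.sq_sqrt hp0]
    field_simp
  refine ⟨((√p / ‖v‖ ^ 2 : ℝ) : ℂ) • v, ⟨_, rfl⟩, ?_, ?_, ?_⟩
  · rw [inner_smul_right, hvv, norm_mul, norm_pow, Complex.norm_real, Complex.norm_real, norm_norm,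
      Real.norm_of_nonneg (by positivity), div_mul_cancel₀ _ (by positivity), Real.sq_sqrt hp0]
  · rw [hw, hsum]
    have : 0 ≤ ∑ i, ‖a i - (inner ℂ v (a i) / inner ℂ v v) • v‖ ^ 2 :=
      Finset.sum_nonneg fun i _ => by positivity
    linarith
  · intro hle i
    rw [hw, hsum] at hle
    exact ⟨_, eq_of_sum_norm_sub_sq_nonpos (a := a)
      (b := fun i => (inner ℂ v (a i) / inner ℂ v v) • v) (by linarith) i⟩

/-- If the first functional need only be dominated, then energy is saved strictly unless the
family is collinear. -/
lemma exists_single_dominated {v₁ v₂ : E} (hv : LinearIndependent ℂ ![v₁, v₂]) (a : ι → E) :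
    ∃ w : E, ‖inner ℂ v₁ w‖ ^ 2 ≤ ∑ i, ‖inner ℂ v₁ (a i)‖ ^ 2 ∧
      ‖inner ℂ v₂ w‖ ^ 2 = ∑ i, ‖inner ℂ v₂ (a i)‖ ^ 2 ∧
      (∑ i, ‖a i‖ ^ 2 ≤ ‖w‖ ^ 2 → ∃ e : E, ∀ i, ∃ c : ℂ, a i = c • e) := by
  by_cases h12 : inner ℂ v₁ v₂ = 0
  swap
  · obtain ⟨w, hw1, hw2, -, hw⟩ := exists_single_of_linearIndependent hv a
    exact ⟨w, hw1.le, hw2, hw h12⟩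
  -- For orthogonal `v₁, v₂` the cross term gives no rigidity. A multiple of `v₂` is invisible to
  -- `v₁` and is the cheapest way to match the second functional.
  obtain ⟨w, ⟨r, hr⟩, hw2, -, hw⟩ := exists_single_of_ne_zero (v := v₂) (hv.ne_zero 1) a
  refine ⟨w, ?_, hw2, fun hle => ⟨v₂, hw hle⟩⟩
  rw [hr, inner_smul_right, h12, mul_zero, norm_zero, zero_pow two_ne_zero]
  exact Finset.sum_nonneg fun i _ => by positivity

end HilbertSpace

/-! ### Rank reduction of covariances through Gram factors -/

section RankOne

variable {n : ℕ}

/-- The vector `hᴴ` in Euclidean space. -/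
def conjVec (h : Fin n → ℂ) : EuclideanSpace ℂ (Fin n) := WithLp.toLp 2 (star h)

lemma norm_inner_conjVec (h x : Fin n → ℂ) :
    ‖inner ℂ (conjVec h) (conjVec x)‖ = ‖x ⬝ᵥ star h‖ := by
  rw [← norm_star (x ⬝ᵥ star h)]
  congr 1
  simp [conjVec, PiLp.inner_apply, dotProduct, mul_comm]

lemma inner_conjVec (h x : Fin n → ℂ) :
    inner ℂ (conjVec h) (conjVec x) = h ⬝ᵥ star x := by
  simp [conjVec, PiLp.inner_apply, dotProduct, mul_comm]

lemma conjVec_ne_zero {h : Fin n → ℂ} (hh : h ≠ 0) : conjVec h ≠ 0 := by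
  intro h0
  apply hh
  have : star h = 0 := by simpa [conjVec] using h0
  simpa using this

lemma linearIndependent_conjVec {h₁ h₂ : Fin n → ℂ} (hh : LinearIndependent ℂ ![h₁, h₂]) :
    LinearIndependent ℂ ![conjVec h₁, conjVec h₂] := by
  rw [LinearIndependent.pair_iff] at hh ⊢
  intro s t hst
  have h0 : star s • h₁ + star t • h₂ = 0 := by
    funext i
    have := congrArg (fun z : EuclideanSpace ℂ (Fin n) => star (z i)) hst
    simpa [conjVec] using this
  simpa using hh _ _ h0

open Matrix

lemma rxPower_add (h : Fin n → ℂ) (A B : Matrix (Fin n) (Fin n) ℂ) :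
    rxPower h (A + B) = rxPower h A + rxPower h B := by
  simp [rxPower, Matrix.add_mulVec]

lemma rxPower_zero (h : Fin n → ℂ) : rxPower h 0 = 0 := by
  simp [rxPower]

lemma rxPower_real_smul (h : Fin n → ℂ) (r : ℝ) (A : Matrix (Fin n) (Fin n) ℂ) :
    rxPower h (r • A) = r * rxPower h A := by
  simp [rxPower, Matrix.smul_mulVec]

lemma rxPower_smul_left (c : ℂ) (h : Fin n → ℂ) (A : Matrix (Fin n) (Fin n) ℂ) :
    rxPower (c • h) A = ‖c‖ ^ 2 * rxPower h A := by
  have : (c • h) ⬝ᵥ A *ᵥ star (c • h) = ((‖c‖ ^ 2 : ℝ) : ℂ) * (h ⬝ᵥ A *ᵥ star h) := by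
    rw [star_smul, Matrix.mulVec_smul, smul_dotProduct, dotProduct_smul, smul_eq_mul, smul_eq_mul,
      ← mul_assoc]
    congr 1
    rw [Complex.star_def, Complex.mul_conj]
    simp [Complex.normSq_eq_norm_sq]
  rw [rxPower, this, Complex.re_ofReal_mul, rxPower]

lemma rxPower_conjTranspose_mul_self (h : Fin n → ℂ) (A : Matrix (Fin n) (Fin n) ℂ) :
    rxPower h (Aᴴ * A) = ∑ i, ‖A i ⬝ᵥ star h‖ ^ 2 := by
  have : h ⬝ᵥ (Aᴴ * A) *ᵥ star h = ((∑ i, ‖A i ⬝ᵥ star h‖ ^ 2 : ℝ) : ℂ) := by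
    have hA : h ᵥ* Aᴴ = star (A *ᵥ star h) := by rw [star_mulVec, star_star]
    rw [← mulVec_mulVec, dotProduct_mulVec, hA, dotProduct]
    push_cast
    refine Finset.sum_congr rfl fun i _ => ?_
    rw [Pi.star_apply, Complex.star_def, Complex.conj_mul']
    rfl
  rw [rxPower, this, Complex.ofReal_re]

lemma trace_conjTranspose_mul_self_re (A : Matrix (Fin n) (Fin n) ℂ) :
    (Aᴴ * A).trace.re = ∑ i, ‖conjVec (A i)‖ ^ 2 := by
  simp only [EuclideanSpace.norm_sq_eq, conjVec, Matrix.trace, Matrix.diag, Matrix.mul_apply,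
    Matrix.conjTranspose_apply, Complex.re_sum]
  rw [Finset.sum_comm]
  refine Finset.sum_congr rfl fun i _ => Finset.sum_congr rfl fun j _ => ?_
  rw [mul_comm, Complex.star_def, Complex.mul_conj, Complex.ofReal_re,
    Complex.normSq_eq_norm_sq]
  simp

/-- The rank-one covariance `wᴴ w`. -/
def rankOne (w : Fin n → ℂ) : Matrix (Fin n) (Fin n) ℂ := vecMulVec (star w) w

lemma rankOne_posSemidef (w : Fin n → ℂ) : (rankOne w).PosSemidef :=
  Matrix.posSemidef_vecMulVec_star_self w

lemma rankOne_rank_le (w : Fin n → ℂ) : (rankOne w).rank ≤ 1 := Matrix.rank_vecMulVec_le _ _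

lemma rxPower_rankOne (h w : Fin n → ℂ) : rxPower h (rankOne w) = ‖w ⬝ᵥ star h‖ ^ 2 := by
  have : h ⬝ᵥ (rankOne w) *ᵥ star h = ((‖w ⬝ᵥ star h‖ ^ 2 : ℝ) : ℂ) := by
    rw [rankOne, vecMulVec_mulVec, dotProduct_smul, op_smul_eq_smul, smul_eq_mul,
      dotProduct_star, Complex.star_def, Complex.conj_mul', RCLike.norm_conj]
    push_cast
    rfl
  rw [rxPower, this, Complex.ofReal_re]

lemma trace_rankOne_re (w : Fin n → ℂ) : (rankOne w).trace.re = ‖conjVec w‖ ^ 2 := by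
  simp only [EuclideanSpace.norm_sq_eq, conjVec, Matrix.trace, Matrix.diag, rankOne,
    vecMulVec_apply, Complex.re_sum]
  refine Finset.sum_congr rfl fun i _ => ?_
  rw [mul_comm, Pi.star_apply, Complex.star_def, Complex.mul_conj, Complex.ofReal_re,
    Complex.normSq_eq_norm_sq]
  simp

lemma rank_conjTranspose_mul_self_le_one {A : Matrix (Fin n) (Fin n) ℂ}
    {e : EuclideanSpace ℂ (Fin n)} (he : ∀ i, ∃ c : ℂ, conjVec (A i) = c • e) :
    (Aᴴ * A).rank ≤ 1 := by
  choose c hc using he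
  have : A = vecMulVec (star c) (fun j => star (e j)) := by
    ext i j
    have := congrArg (fun z : EuclideanSpace ℂ (Fin n) => star (z j)) (hc i)
    simpa [conjVec, vecMulVec_apply] using this
  rw [Matrix.rank_conjTranspose_mul_self, this]
  exact Matrix.rank_vecMulVec_le _ _

lemma exists_conjVec_eq (w : EuclideanSpace ℂ (Fin n)) : ∃ x, conjVec x = w :=
  ⟨star w.ofLp, by simp [conjVec]⟩

lemma exists_gram {Q : Matrix (Fin n) (Fin n) ℂ} (hQ : Q.PosSemidef) :
    ∃ A : Matrix (Fin n) (Fin n) ℂ, Q = Aᴴ * A := by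
  open scoped MatrixOrder in
  exact CStarAlgebra.nonneg_iff_eq_star_mul_self.1 hQ.nonneg

lemma rxPower_nonneg (h : Fin n → ℂ) {Q : Matrix (Fin n) (Fin n) ℂ} (hQ : Q.PosSemidef) :
    0 ≤ rxPower h Q := by
  obtain ⟨A, rfl⟩ := exists_gram hQ
  rw [rxPower_conjTranspose_mul_self]
  exact Finset.sum_nonneg fun i _ => by positivity

lemma trace_re_nonneg {Q : Matrix (Fin n) (Fin n) ℂ} (hQ : Q.PosSemidef) : 0 ≤ Q.trace.re := by
  obtain ⟨A, rfl⟩ := exists_gram hQ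
  rw [trace_conjTranspose_mul_self_re]
  exact Finset.sum_nonneg fun i _ => by positivity

lemma eq_zero_of_trace_re_nonpos {Q : Matrix (Fin n) (Fin n) ℂ} (hQ : Q.PosSemidef)
    (h : Q.trace.re ≤ 0) : Q = 0 := by
  obtain ⟨A, rfl⟩ := exists_gram hQ
  rw [trace_conjTranspose_mul_self_re] at h
  have : A = 0 := by
    ext i j
    have := eq_of_sum_norm_sub_sq_nonpos (a := fun i => conjVec (A i)) (b := 0) (by simpa using h) i
    have := congrArg (fun z : EuclideanSpace ℂ (Fin n) => star (z j)) this
    simpa [conjVec] using this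
  simp [this]

/-- A covariance can be replaced by one of rank at most one with the same received powers at two
receivers and no more transmit power. -/
lemma exists_rank_le_one {h₁ h₂ : Fin n → ℂ} (hh₁ : h₁ ≠ 0) (hh₂ : h₂ ≠ 0)
    {Q : Matrix (Fin n) (Fin n) ℂ} (hQ : Q.PosSemidef) :
    ∃ Q' : Matrix (Fin n) (Fin n) ℂ, Q'.PosSemidef ∧ Q'.rank ≤ 1 ∧
      rxPower h₁ Q' = rxPower h₁ Q ∧ rxPower h₂ Q' = rxPower h₂ Q ∧
      Q'.trace.re ≤ Q.trace.re ∧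
      (h₁ ⬝ᵥ star h₂ ≠ 0 → Q.trace.re ≤ Q'.trace.re → Q.rank ≤ 1) := by
  obtain ⟨A, rfl⟩ := exists_gram hQ
  simp only [rxPower_conjTranspose_mul_self, trace_conjTranspose_mul_self_re]
  by_cases hli : LinearIndependent ℂ ![h₁, h₂]
  · obtain ⟨w, hw1, hw2, hw, hstrict⟩ := exists_single_of_linearIndependent
      (linearIndependent_conjVec hli) (fun i => conjVec (A i))
    obtain ⟨x, rfl⟩ := exists_conjVec_eq w
    simp only [norm_inner_conjVec] at hw1 hw2
    rw [inner_conjVec] at hstrict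
    refine ⟨rankOne x, rankOne_posSemidef x, rankOne_rank_le x, ?_⟩
    rw [rxPower_rankOne, rxPower_rankOne, trace_rankOne_re]
    refine ⟨hw1, hw2, hw, fun hne hle => ?_⟩
    obtain ⟨e, he⟩ := hstrict hne hle
    exact rank_conjTranspose_mul_self_le_one he
  -- Proportional channels: matching one received power matches the other.
  · obtain ⟨c, rfl⟩ : ∃ c : ℂ, h₂ = c • h₁ := by
      rw [LinearIndependent.pair_iff' hh₁] at hli
      push Not at hli
      obtain ⟨c, hc⟩ := hli
      exact ⟨c, hc.symm⟩
    obtain ⟨w, -, hw1, hw, hstrict⟩ := exists_single_of_ne_zero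
      (conjVec_ne_zero hh₁) (fun i => conjVec (A i))
    obtain ⟨x, rfl⟩ := exists_conjVec_eq w
    simp only [norm_inner_conjVec] at hw1
    refine ⟨rankOne x, rankOne_posSemidef x, rankOne_rank_le x, ?_⟩
    rw [rxPower_rankOne, rxPower_rankOne, trace_rankOne_re]
    refine ⟨hw1, ?_, hw, fun _ hle => rank_conjTranspose_mul_self_le_one (hstrict hle)⟩
    simp only [star_smul, dotProduct_smul, norm_smul, mul_pow, hw1, Finset.mul_sum]

/-- For independent channels, a covariance of rank at least two wastes transmit power if the
received power need not be matched but only dominated at the first receiver. -/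
lemma exists_dominated {h₁ h₂ : Fin n → ℂ} (hli : LinearIndependent ℂ ![h₁, h₂])
    {Q : Matrix (Fin n) (Fin n) ℂ} (hQ : Q.PosSemidef) :
    ∃ Q' : Matrix (Fin n) (Fin n) ℂ, Q'.PosSemidef ∧
      rxPower h₁ Q' ≤ rxPower h₁ Q ∧ rxPower h₂ Q' = rxPower h₂ Q ∧
      (Q.trace.re ≤ Q'.trace.re → Q.rank ≤ 1) := by
  obtain ⟨A, rfl⟩ := exists_gram hQ
  simp only [rxPower_conjTranspose_mul_self, trace_conjTranspose_mul_self_re]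
  obtain ⟨w, hw1, hw2, hstrict⟩ := exists_single_dominated
    (linearIndependent_conjVec hli) (fun i => conjVec (A i))
  obtain ⟨x, rfl⟩ := exists_conjVec_eq w
  simp only [norm_inner_conjVec] at hw1 hw2
  refine ⟨rankOne x, rankOne_posSemidef x, ?_⟩
  rw [rxPower_rankOne, rxPower_rankOne, trace_rankOne_re]
  refine ⟨hw1, hw2, fun hle => ?_⟩
  obtain ⟨e, he⟩ := hstrict hle
  exact rank_conjTranspose_mul_self_le_one he

end RankOne

/-! ### Compactness and existence of maximizers -/

section Existence

open Matrix

variable {n m : ℕ}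

/-- Covariances parametrized by Gram factors. -/
def gram (A : Matrix (Fin n) (Fin n) ℂ × Matrix (Fin n) (Fin n) ℂ × Matrix (Fin n) (Fin n) ℂ) :
    Covariances n :=
  ⟨A.1ᴴ * A.1, A.2.1ᴴ * A.2.1, A.2.2ᴴ * A.2.2⟩

lemma continuous_rxPower_comp {X : Type*} [TopologicalSpace X] (h : Fin n → ℂ)
    {f : X → Matrix (Fin n) (Fin n) ℂ} (hf : Continuous f) :
    Continuous fun x => rxPower h (f x) :=
  Complex.continuous_re.comp
    (Continuous.dotProduct continuous_const (Continuous.matrix_mulVec hf continuous_const))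

lemma continuous_gram_Q0 : Continuous fun A => (gram (n := n) A).Q0 :=
  (continuous_fst.matrix_conjTranspose).matrix_mul continuous_fst

lemma continuous_gram_Qa : Continuous fun A => (gram (n := n) A).Qa :=
  have h : Continuous fun A : Matrix (Fin n) (Fin n) ℂ × Matrix (Fin n) (Fin n) ℂ ×
    Matrix (Fin n) (Fin n) ℂ => A.2.1 := by fun_prop
  h.matrix_conjTranspose.matrix_mul h

lemma continuous_gram_Qc : Continuous fun A => (gram (n := n) A).Qc :=
  have h : Continuous fun A : Matrix (Fin n) (Fin n) ℂ × Matrix (Fin n) (Fin n) ℂ ×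
    Matrix (Fin n) (Fin n) ℂ => A.2.2 := by fun_prop
  h.matrix_conjTranspose.matrix_mul h

lemma posSemidef_gram (A : Matrix (Fin n) (Fin n) ℂ × Matrix (Fin n) (Fin n) ℂ ×
    Matrix (Fin n) (Fin n) ℂ) :
    (gram A).Q0.PosSemidef ∧ (gram A).Qa.PosSemidef ∧ (gram A).Qc.PosSemidef :=
  ⟨posSemidef_conjTranspose_mul_self _, posSemidef_conjTranspose_mul_self _,
    posSemidef_conjTranspose_mul_self _⟩

/-- Gram matrices are automatically positive semidefinite, so only closed scalar inequalities
remain. -/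
lemma isClosed_setOf_isAdmissible_gram (h : Fin (m + 1) → Fin n → ℂ) (P τ : ℝ) :
    IsClosed {A | IsAdmissible h P τ (gram A)} := by
  have heq : {A | IsAdmissible h P τ (gram (n := n) A)} =
      (⋂ k, {A | 0 ≤ rxPower (h k) (gram A).Q0
        - sinrThreshold τ * rxPower (h k) ((gram A).Qa + (gram A).Qc) - sinrThreshold τ}) ∩
      {A | ((gram A).Q0 + (gram A).Qa + (gram A).Qc).trace.re ≤ P} := by
    ext A
    simp only [Set.mem_ofPred_eq, Set.mem_inter_iff, Set.mem_iInter]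
    exact ⟨fun hA => ⟨hA.multicast, hA.power⟩, fun hA =>
      ⟨hA.1, hA.2, (posSemidef_gram A).1, (posSemidef_gram A).2.1, (posSemidef_gram A).2.2⟩⟩
  rw [heq]
  refine (isClosed_iInter fun k => isClosed_le continuous_const ?_).inter
    (isClosed_le ?_ continuous_const)
  · exact ((continuous_rxPower_comp _ continuous_gram_Q0).sub (continuous_const.mul
      (continuous_rxPower_comp _ (continuous_gram_Qa.add continuous_gram_Qc)))).sub
      continuous_const
  · exact Complex.continuous_re.comp
      ((continuous_gram_Q0.add continuous_gram_Qa).add continuous_gram_Qc).matrix_trace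

lemma norm_entry_le_of_trace_le {A : Matrix (Fin n) (Fin n) ℂ} {P : ℝ}
    (hA : (Aᴴ * A).trace.re ≤ P) (i j : Fin n) : ‖A i j‖ ≤ √P := by
  refine Real.le_sqrt_of_sq_le (le_trans ?_ hA)
  rw [trace_conjTranspose_mul_self_re]
  refine le_trans ?_ (Finset.single_le_sum (f := fun i => ‖conjVec (A i)‖ ^ 2)
    (fun i _ => by positivity) (Finset.mem_univ i))
  simp only [EuclideanSpace.norm_sq_eq]
  refine le_trans (le_of_eq ?_) (Finset.single_le_sum (f := fun j => ‖(conjVec (A i)) j‖ ^ 2)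
    (fun j _ => by positivity) (Finset.mem_univ j))
  simp [conjVec]

lemma IsAdmissible.trace_add_le {h : Fin (m + 1) → Fin n → ℂ} {P τ : ℝ} {Q : Covariances n}
    (hQ : IsAdmissible h P τ Q) : Q.Q0.trace.re + Q.Qa.trace.re + Q.Qc.trace.re ≤ P := by
  simpa using hQ.power

/-- A continuous objective attains its maximum over a closed nonempty set of admissible
covariances. -/
lemma exists_isOptimal {h : Fin (m + 1) → Fin n → ℂ} {P τ : ℝ} {S : Set (Covariances n)}
    (hS : ∀ Q ∈ S, IsAdmissible h P τ Q) (hclosed : IsClosed (gram ⁻¹' S))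
    {f : Covariances n → ℝ} (hf : Continuous fun A => f (gram A)) (hne : S.Nonempty) :
    ∃ Q, IsOptimal S f Q := by
  have hex : ∀ Q ∈ S, ∃ A, gram A = Q := by
    rintro ⟨Q0, Qa, Qc⟩ hQ
    obtain ⟨A0, hA0⟩ := exists_gram (hS _ hQ).psd_Q0
    obtain ⟨Aa, hAa⟩ := exists_gram (hS _ hQ).psd_Qa
    obtain ⟨Ac, hAc⟩ := exists_gram (hS _ hQ).psd_Qc
    simp only at hA0 hAa hAc
    exact ⟨(A0, Aa, Ac), by rw [gram, hA0, hAa, hAc]⟩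
  set K : Set (Matrix (Fin n) (Fin n) ℂ) :=
    Set.univ.pi fun _ => Set.univ.pi fun _ => Metric.closedBall 0 (√P) with hK
  have hKc : IsCompact K :=
    isCompact_univ_pi fun _ => isCompact_univ_pi fun _ => isCompact_closedBall _ _
  have hKmem : ∀ A : Matrix (Fin n) (Fin n) ℂ, (Aᴴ * A).trace.re ≤ P → A ∈ K := by
    intro A hA i _ j _
    rw [mem_closedBall_zero_iff]
    exact norm_entry_le_of_trace_le hA i j
  have hcompact : IsCompact (gram ⁻¹' S) := by
    refine (hKc.prod (hKc.prod hKc)).of_isClosed_subset hclosed ?_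
    intro A hA
    have hadm := hS _ hA
    have htr := hadm.trace_add_le
    have h0 := trace_re_nonneg hadm.psd_Q0
    have ha := trace_re_nonneg hadm.psd_Qa
    have hc := trace_re_nonneg hadm.psd_Qc
    exact ⟨hKmem _ (by change (gram A).Q0.trace.re ≤ P; linarith),
      hKmem _ (by change (gram A).Qa.trace.re ≤ P; linarith),
      hKmem _ (by change (gram A).Qc.trace.re ≤ P; linarith)⟩
  obtain ⟨Q, hQ⟩ := hne
  obtain ⟨A, rfl⟩ := hex Q hQ
  obtain ⟨B, hB, hmax⟩ := hcompact.exists_isMaxOn ⟨A, hQ⟩ hf.continuousOn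
  refine ⟨gram B, hB, fun R hR => ?_⟩
  obtain ⟨C, rfl⟩ := hex R hR
  exact hmax hR

end Existence

/-! ### The inner problem at fixed slack -/

section TwoReceivers

open Matrix

variable {n : ℕ} {h : Fin (1 + 1) → Fin n → ℂ} {P τ α : ℝ}

lemma sinrThreshold_pos (hτ : 0 < τ) : 0 < sinrThreshold τ :=
  sub_pos.2 (Real.one_lt_rpow one_lt_two hτ)

lemma mem_innerFeasible_iff {Q : Covariances n} :
    Q ∈ innerFeasible h P τ α ↔ IsAdmissible h P τ Q ∧
      rxPower (h 1) Q.Qc ≤ (α - 1) * (1 + rxPower (h 1) Q.Qa) := by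
  simp [innerFeasible]

lemma isAdmissible_iff {Q : Covariances n} :
    IsAdmissible h P τ Q ↔
      (∀ k, sinrThreshold τ * (rxPower (h k) Q.Qa + rxPower (h k) Q.Qc) + sinrThreshold τ
        ≤ rxPower (h k) Q.Q0) ∧
      Q.Q0.trace.re + Q.Qa.trace.re + Q.Qc.trace.re ≤ P ∧
      Q.Q0.PosSemidef ∧ Q.Qa.PosSemidef ∧ Q.Qc.PosSemidef := by
  constructor
  · intro hQ
    refine ⟨fun k => ?_, hQ.trace_add_le, hQ.psd_Q0, hQ.psd_Qa, hQ.psd_Qc⟩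
    have := hQ.multicast k
    rw [rxPower_add] at this
    linarith
  · rintro ⟨h1, h2, h3, h4, h5⟩
    refine ⟨fun k => ?_, by simpa using h2, h3, h4, h5⟩
    have := h1 k
    rw [rxPower_add]
    linarith

/-- The unit receiver noise contributes a threshold term that is strictly positive because `τ > 0`.
This rules out zero channels and rank zero. -/
lemma IsAdmissible.rxPower_Q0_pos {Q : Covariances n} (hτ : 0 < τ) (hQ : IsAdmissible h P τ Q)
    (k : Fin (1 + 1)) : 0 < rxPower (h k) Q.Q0 := by
  have ht := sinrThreshold_pos hτ
  have h1 := (isAdmissible_iff.1 hQ).1 k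
  have h2 := rxPower_nonneg (h k) hQ.psd_Qa
  have h3 := rxPower_nonneg (h k) hQ.psd_Qc
  nlinarith [mul_nonneg ht.le (add_nonneg h2 h3)]

lemma IsAdmissible.channel_ne_zero {Q : Covariances n} (hτ : 0 < τ) (hQ : IsAdmissible h P τ Q)
    (k : Fin (1 + 1)) : h k ≠ 0 := by
  intro h0
  have := hQ.rxPower_Q0_pos hτ k
  rw [h0] at this
  simp [rxPower] at this

lemma rank_eq_one_of_rxPower_pos {g : Fin n → ℂ} {Q : Matrix (Fin n) (Fin n) ℂ}
    (hQ : Q.rank ≤ 1) (hg : 0 < rxPower g Q) : Q.rank = 1 := by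
  refine le_antisymm hQ (Nat.one_le_iff_ne_zero.2 fun h0 => ?_)
  have hz : Q = 0 := by
    rw [Matrix.rank, Submodule.finrank_eq_zero, LinearMap.range_eq_bot] at h0
    ext i j
    simpa using congrFun (LinearMap.congr_fun h0 (Pi.single j 1)) i
  rw [hz, rxPower_zero] at hg
  exact lt_irrefl _ hg

lemma innerObjective_eq (Q : Covariances n) :
    innerObjective h α Q = (1 + (rxPower (h 0) Q.Qc + rxPower (h 0) Q.Qa))
      / (α * (1 + rxPower (h 0) Q.Qa)) := by
  rw [innerObjective, rxPower_add]

lemma innerObjective_pos {Q : Covariances n} (hα : 1 ≤ α) (ha : Q.Qa.PosSemidef)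
    (hc : Q.Qc.PosSemidef) : 0 < innerObjective h α Q := by
  rw [innerObjective_eq]
  have h2 := rxPower_nonneg (h 0) ha
  have h3 := rxPower_nonneg (h 0) hc
  positivity

lemma continuous_innerObjective_gram {X : Type*} [TopologicalSpace X]
    {A : X → Matrix (Fin n) (Fin n) ℂ × Matrix (Fin n) (Fin n) ℂ × Matrix (Fin n) (Fin n) ℂ}
    (hA : Continuous A) {β : X → ℝ} (hβ : Continuous β) (hβ1 : ∀ x, 1 ≤ β x) :
    Continuous fun x => innerObjective h (β x) (gram (A x)) := by
  have hQa : Continuous fun x => (gram (A x)).Qa := continuous_gram_Qa.comp hA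
  have hQc : Continuous fun x => (gram (A x)).Qc := continuous_gram_Qc.comp hA
  refine Continuous.div (continuous_const.add (continuous_rxPower_comp _ (hQc.add hQa)))
    (hβ.mul (continuous_const.add (continuous_rxPower_comp _ hQa))) fun x => ?_
  have h1 := hβ1 x
  have h2 := rxPower_nonneg (h 0) (posSemidef_gram (A x)).2.1
  positivity

lemma exists_isOptimal_inner (hα : 1 ≤ α) (hne : (innerFeasible h P τ α).Nonempty) :
    ∃ Q, IsOptimal (innerFeasible h P τ α) (innerObjective h α) Q := by
  refine exists_isOptimal (fun Q hQ => hQ.1) ?_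
    (continuous_innerObjective_gram continuous_id continuous_const fun _ => hα) hne
  have heq : gram ⁻¹' (innerFeasible h P τ α) = {A | IsAdmissible h P τ (gram A)} ∩
      {A | rxPower (h 1) (gram A).Qc ≤ (α - 1) * (1 + rxPower (h 1) (gram A).Qa)} := by
    ext A
    exact mem_innerFeasible_iff
  rw [heq]
  exact (isClosed_setOf_isAdmissible_gram h P τ).inter
    (isClosed_le (continuous_rxPower_comp _ continuous_gram_Qc) (continuous_const.mul
      (continuous_const.add (continuous_rxPower_comp _ continuous_gram_Qa))))

/-- `Q'` is obtained from `Q` by replacing the multicast covariance and the artificial noise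
without harm: no more power, no less noise at the eavesdropper, no more at receiver `0`. -/
structure Improves (h : Fin (1 + 1) → Fin n → ℂ) (Q Q' : Covariances n) : Prop where
  psd_Q0 : Q'.Q0.PosSemidef
  psd_Qa : Q'.Qa.PosSemidef
  rx_Q0 : ∀ k, rxPower (h k) Q'.Q0 = rxPower (h k) Q.Q0
  rx_Qa_zero : rxPower (h 0) Q'.Qa ≤ rxPower (h 0) Q.Qa
  rx_Qa_one : rxPower (h 1) Q'.Qa = rxPower (h 1) Q.Qa
  Qc_eq : Q'.Qc = Q.Qc
  trace_le : Q'.Q0.trace.re + Q'.Qa.trace.re ≤ Q.Q0.trace.re + Q.Qa.trace.re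

/-- Unchanged noise at the eavesdropper preserves the secrecy constraint; less noise at receiver `0`
only relaxes its multicast constraint. -/
lemma Improves.mem_innerFeasible {Q Q' : Covariances n} (hτ : 0 < τ) (hi : Improves h Q Q')
    (hQ : Q ∈ innerFeasible h P τ α) : Q' ∈ innerFeasible h P τ α := by
  have ht := sinrThreshold_pos hτ
  rw [mem_innerFeasible_iff, isAdmissible_iff] at hQ ⊢
  obtain ⟨⟨hm, htr, -, -, hc⟩, hs⟩ := hQ
  have hle : ∀ k, rxPower (h k) Q'.Qa ≤ rxPower (h k) Q.Qa :=
    Fin.forall_fin_two.2 ⟨hi.rx_Qa_zero, hi.rx_Qa_one.le⟩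
  rw [hi.Qc_eq, hi.rx_Qa_one]
  refine ⟨⟨fun k => ?_, ?_, hi.psd_Q0, hi.psd_Qa, hc⟩, hs⟩
  · rw [hi.rx_Q0]
    nlinarith [hm k, mul_le_mul_of_nonneg_left (hle k) ht.le]
  · linarith [hi.trace_le]

/-- The objective is `(1 + C / (1 + A)) / α`, which is nonincreasing in the noise power `A` at
receiver `0`. -/
lemma Improves.innerObjective_le {Q Q' : Covariances n} (hα : 1 ≤ α) (hi : Improves h Q Q')
    (hc : Q.Qc.PosSemidef) : innerObjective h α Q ≤ innerObjective h α Q' := by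
  rw [innerObjective_eq, innerObjective_eq, hi.Qc_eq]
  have h1 := rxPower_nonneg (h 0) hi.psd_Qa
  have h2 := rxPower_nonneg (h 0) hc
  have h3 := hi.rx_Qa_zero
  have hα0 : 0 < α := by linarith
  have h4 : 0 ≤ rxPower (h 0) Q.Qa := h1.trans h3
  rw [div_le_div_iff₀ (by positivity) (by positivity)]
  nlinarith [mul_nonneg hα0.le (mul_nonneg h2 (sub_nonneg.2 h3))]

lemma Improves.isOptimal {Q Q' : Covariances n} (hτ : 0 < τ) (hα : 1 ≤ α)
    (hi : Improves h Q Q') (hQ : IsOptimal (innerFeasible h P τ α) (innerObjective h α) Q) :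
    IsOptimal (innerFeasible h P τ α) (innerObjective h α) Q' :=
  ⟨hi.mem_innerFeasible hτ hQ.1, fun R hR =>
    (hQ.2 R hR).trans (hi.innerObjective_le hα hQ.1.1.psd_Qc)⟩

/-- Optimal solutions of the inner problem can be turned into low-rank ones. -/
lemma exists_rank_le_one_isOptimal (hτ : 0 < τ) (hα : 1 ≤ α) {Q : Covariances n}
    (hQ : IsOptimal (innerFeasible h P τ α) (innerObjective h α) Q) :
    ∃ Q', IsOptimal (innerFeasible h P τ α) (innerObjective h α) Q' ∧
      Q'.Q0.rank = 1 ∧ Q'.Qa.rank ≤ 1 := by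
  have hadm := hQ.1.1
  have h0 := hadm.channel_ne_zero hτ 0
  have h1 := hadm.channel_ne_zero hτ 1
  obtain ⟨R0, hp0, hr0, h00, h01, ht0, -⟩ := exists_rank_le_one h0 h1 hadm.psd_Q0
  obtain ⟨Ra, hpa, hra, ha0, ha1, hta, -⟩ := exists_rank_le_one h0 h1 hadm.psd_Qa
  have hi : Improves h Q ⟨R0, Ra, Q.Qc⟩ :=
    ⟨hp0, hpa, Fin.forall_fin_two.2 ⟨h00, h01⟩, ha0.le, ha1, rfl, add_le_add ht0 hta⟩
  have hopt := hi.isOptimal hτ hα hQ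
  exact ⟨_, hopt, rank_eq_one_of_rxPower_pos hr0 (hopt.1.1.rxPower_Q0_pos hτ 0), hra⟩

/-- Signalling in the null space of the eavesdropper's channel. -/
lemma exists_nulling_covariance {h₁ h₂ : Fin n → ℂ} (hli : LinearIndependent ℂ ![h₁, h₂]) :
    ∃ R : Matrix (Fin n) (Fin n) ℂ, R.PosSemidef ∧ rxPower h₁ R = 1 ∧ rxPower h₂ R = 0 := by
  obtain ⟨d, -, -, -, h1, h2⟩ := exists_dual_vector (linearIndependent_conjVec hli)
  obtain ⟨x, rfl⟩ := exists_conjVec_eq d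
  refine ⟨rankOne x, rankOne_posSemidef x, ?_, ?_⟩
  · rw [rxPower_rankOne, ← norm_inner_conjVec, h1]; simp
  · rw [rxPower_rankOne, ← norm_inner_conjVec, h2]; simp

lemma exists_pos_mul_le {g T : ℝ} (hg : 0 < g) (hT : 0 ≤ T) : ∃ ε : ℝ, 0 < ε ∧ ε * T ≤ g := by
  -- The `+ 1` covers `T = 0`.
  refine ⟨g / (T + 1), by positivity, ?_⟩
  rw [div_mul_eq_mul_div, div_le_iff₀ (by positivity)]
  nlinarith

/-- For independent channels the power budget is exhausted at every optimal solution. -/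
lemma le_trace_of_isOptimal_inner (hτ : 0 < τ) (hα : 1 ≤ α)
    (hli : LinearIndependent ℂ ![h 0, h 1]) {Q : Covariances n}
    (hQ : IsOptimal (innerFeasible h P τ α) (innerObjective h α) Q) :
    P ≤ Q.Q0.trace.re + Q.Qa.trace.re + Q.Qc.trace.re := by
  by_contra! hlt
  have ht := sinrThreshold_pos hτ
  set t := sinrThreshold τ with htdef
  obtain ⟨R, hR, hR0, hR1⟩ := exists_nulling_covariance hli
  have hRt := trace_re_nonneg hR
  obtain ⟨ε, hε, hεle⟩ := exists_pos_mul_le (sub_pos.2 hlt)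
    (mul_nonneg (by linarith : (0 : ℝ) ≤ 1 + t) hRt)
  obtain ⟨⟨hm, -, hp0, hpa, hpc⟩, hs⟩ :=
    (mem_innerFeasible_iff.trans (and_congr_left' isAdmissible_iff)).1 hQ.1
  -- Each extra unit of confidential signal raises the multicast requirement by `t` units, hence the
  -- share `t * ε` for `Q0` and the cost factor `1 + t`.
  have hmem : (⟨Q.Q0 + (t * ε) • R, Q.Qa, Q.Qc + ε • R⟩ : Covariances n)
      ∈ innerFeasible h P τ α := by
    rw [mem_innerFeasible_iff, isAdmissible_iff]
    refine ⟨⟨fun k => ?_, ?_, hp0.add (hR.smul (mul_nonneg ht.le hε.le)), hpa,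
      hpc.add (hR.smul hε.le)⟩, ?_⟩
    · simp only [rxPower_add, rxPower_real_smul]
      linarith [hm k]
    · simp only [trace_add, trace_smul, Complex.add_re, Complex.real_smul, Complex.re_ofReal_mul]
      linarith
    · simp only [rxPower_add, rxPower_real_smul, hR1]
      linarith
  have hle := hQ.2 _ hmem
  rw [innerObjective_eq, innerObjective_eq] at hle
  simp only [rxPower_add, rxPower_real_smul, hR0] at hle
  have ha0 := rxPower_nonneg (h 0) hpa
  rw [div_le_div_iff_of_pos_right (by positivity)] at hle
  linarith

/-- For independent channels all optimal solutions of the inner problem have low rank. -/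
lemma rank_of_isOptimal_inner (hτ : 0 < τ) (hα : 1 ≤ α)
    (hli : LinearIndependent ℂ ![h 0, h 1]) {Q : Covariances n}
    (hQ : IsOptimal (innerFeasible h P τ α) (innerObjective h α) Q) :
    (h 0 ⬝ᵥ star (h 1) ≠ 0 → Q.Q0.rank = 1) ∧ Q.Qa.rank ≤ 1 := by
  have hadm := hQ.1.1
  have htr := hadm.trace_add_le
  constructor
  · intro hne
    obtain ⟨R, hp, -, h0, h1, ht, hst⟩ := exists_rank_le_one (hadm.channel_ne_zero hτ 0)
      (hadm.channel_ne_zero hτ 1) hadm.psd_Q0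
    have hi : Improves h Q ⟨R, Q.Qa, Q.Qc⟩ :=
      ⟨hp, hadm.psd_Qa, Fin.forall_fin_two.2 ⟨h0, h1⟩, le_rfl, rfl, rfl, by simpa using ht⟩
    -- The replacement is again optimal, so it too exhausts the budget and saved nothing.
    have hP := le_trace_of_isOptimal_inner hτ hα hli (hi.isOptimal hτ hα hQ)
    simp only at hP
    exact rank_eq_one_of_rxPower_pos (hst hne (by linarith)) (hadm.rxPower_Q0_pos hτ 0)
  · obtain ⟨R, hp, h0, h1, hst⟩ := exists_dominated hli hadm.psd_Qa
    rcases le_total Q.Qa.trace.re R.trace.re with hle | hle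
    · exact hst hle
    have hi : Improves h Q ⟨Q.Q0, R, Q.Qc⟩ :=
      ⟨hadm.psd_Q0, hp, fun _ => rfl, h0, h1, rfl, by simpa using hle⟩
    have hP := le_trace_of_isOptimal_inner hτ hα hli (hi.isOptimal hτ hα hQ)
    simp only at hP
    exact hst (by linarith)

end TwoReceivers

/-! ### The secrecy rate problem and the degraded case -/

section SecrecyRate

open Matrix

variable {n : ℕ} {h : Fin (1 + 1) → Fin n → ℂ} {P τ : ℝ}

/-- Nonnegative powers and `1 ≤ α` make all logarithm arguments and denominators positive, so both
can be cleared. -/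
lemma mem_srmFeasible_iff {x : Covariances n × ℝ} :
    x ∈ srmFeasible h P τ ↔ 1 ≤ x.2 ∧ x.1 ∈ innerFeasible h P τ x.2 := by
  rw [mem_innerFeasible_iff]
  simp only [srmFeasible, Set.mem_ofPred_eq, Fin.forall_fin_one]
  change (_ ∧ _ ∧ Real.logb 2 (1 + rxPower (h 1) x.1.Qc / (1 + rxPower (h 1) x.1.Qa))
    ≤ Real.logb 2 x.2) ↔ _
  suffices ∀ _ : IsAdmissible h P τ x.1, ∀ _ : 1 ≤ x.2,
      (Real.logb 2 (1 + rxPower (h 1) x.1.Qc / (1 + rxPower (h 1) x.1.Qa)) ≤ Real.logb 2 x.2 ↔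
        rxPower (h 1) x.1.Qc ≤ (x.2 - 1) * (1 + rxPower (h 1) x.1.Qa)) by
    tauto
  intro hadm hx
  have ha := rxPower_nonneg (h 1) hadm.psd_Qa
  have hc := rxPower_nonneg (h 1) hadm.psd_Qc
  rw [Real.logb_le_logb one_lt_two (by positivity) (by positivity), ← le_sub_iff_add_le',
    div_le_iff₀ (by positivity)]

lemma srmObjective_le_iff {x y : Covariances n × ℝ} (hx : x ∈ srmFeasible h P τ)
    (hy : y ∈ srmFeasible h P τ) :
    srmObjective h x ≤ srmObjective h y ↔
      innerObjective h x.2 x.1 ≤ innerObjective h y.2 y.1 := by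
  rw [mem_srmFeasible_iff] at hx hy
  exact Real.logb_le_logb one_lt_two
    (innerObjective_pos hx.1 hx.2.1.psd_Qa hx.2.1.psd_Qc)
    (innerObjective_pos hy.1 hy.2.1.psd_Qa hy.2.1.psd_Qc)

lemma isOptimal_inner_of_isOptimal_srm {x : Covariances n × ℝ}
    (hx : IsOptimal (srmFeasible h P τ) (srmObjective h) x) :
    IsOptimal (innerFeasible h P τ x.2) (innerObjective h x.2) x.1 := by
  have hmem := mem_srmFeasible_iff.1 hx.1
  refine ⟨hmem.2, fun R hR => ?_⟩
  have hR' : (R, x.2) ∈ srmFeasible h P τ := mem_srmFeasible_iff.2 ⟨hmem.1, hR⟩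
  exact (srmObjective_le_iff hR' hx.1).1 (hx.2 _ hR')

lemma isOptimal_srm_of_isOptimal_inner {x : Covariances n × ℝ} {Q : Covariances n}
    (hx : IsOptimal (srmFeasible h P τ) (srmObjective h) x)
    (hQ : IsOptimal (innerFeasible h P τ x.2) (innerObjective h x.2) Q) :
    IsOptimal (srmFeasible h P τ) (srmObjective h) (Q, x.2) := by
  have hmem := mem_srmFeasible_iff.1 hx.1
  have hQ' : (Q, x.2) ∈ srmFeasible h P τ := mem_srmFeasible_iff.2 ⟨hmem.1, hQ.1⟩
  exact ⟨hQ', fun y hy => (hx.2 y hy).trans ((srmObjective_le_iff hx.1 hQ').2 (hQ.2 _ hmem.2))⟩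

/-- The least slack compatible with given covariances. -/
def leastSlack (h : Fin (1 + 1) → Fin n → ℂ) (Q : Covariances n) : ℝ :=
  1 + rxPower (h 1) Q.Qc / (1 + rxPower (h 1) Q.Qa)

lemma one_le_leastSlack {Q : Covariances n} (ha : Q.Qa.PosSemidef) (hc : Q.Qc.PosSemidef) :
    1 ≤ leastSlack h Q := by
  have ha := rxPower_nonneg (h 1) ha
  have hc := rxPower_nonneg (h 1) hc
  rw [leastSlack]
  linarith [div_nonneg hc (by linarith : 0 ≤ 1 + rxPower (h 1) Q.Qa)]

lemma leastSlack_mem_srmFeasible {Q : Covariances n} (hQ : IsAdmissible h P τ Q) :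
    (Q, leastSlack h Q) ∈ srmFeasible h P τ := by
  rw [mem_srmFeasible_iff, mem_innerFeasible_iff]
  refine ⟨one_le_leastSlack hQ.psd_Qa hQ.psd_Qc, hQ, ?_⟩
  have ha := rxPower_nonneg (h 1) hQ.psd_Qa
  simp only [leastSlack]
  rw [add_sub_cancel_left, div_mul_cancel₀ _ (by positivity)]

lemma leastSlack_le {x : Covariances n × ℝ} (hx : x ∈ srmFeasible h P τ) :
    leastSlack h x.1 ≤ x.2 := by
  obtain ⟨-, hQ⟩ := mem_srmFeasible_iff.1 hx
  obtain ⟨hadm, hs⟩ := mem_innerFeasible_iff.1 hQ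
  have ha := rxPower_nonneg (h 1) hadm.psd_Qa
  rw [leastSlack, ← le_sub_iff_add_le', div_le_iff₀ (by positivity)]
  exact hs

lemma innerObjective_anti {Q : Covariances n} {α β : ℝ} (hα : 1 ≤ α) (hαβ : α ≤ β)
    (ha : Q.Qa.PosSemidef) (hc : Q.Qc.PosSemidef) :
    innerObjective h β Q ≤ innerObjective h α Q := by
  have h1 := rxPower_nonneg (h 0) ha
  have h2 := rxPower_nonneg (h 0) hc
  rw [innerObjective_eq, innerObjective_eq]
  gcongr

/-- Enlarging `α` only lowers the objective, so `leastSlack` is the best choice for given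
covariances. This leaves a continuous function on a compact set of factors, although `α` itself is
unbounded. -/
lemma exists_isOptimal_srm (hne : (srmFeasible h P τ).Nonempty) :
    ∃ x, IsOptimal (srmFeasible h P τ) (srmObjective h) x := by
  have hslack : Continuous fun A => leastSlack h (gram (n := n) A) := by
    refine continuous_const.add ((continuous_rxPower_comp _ continuous_gram_Qc).div
      (continuous_const.add (continuous_rxPower_comp _ continuous_gram_Qa)) fun A => ?_)
    have := rxPower_nonneg (h 1) (posSemidef_gram A).2.1
    positivity
  obtain ⟨y, hy⟩ := hne
  obtain ⟨Q, hQ, hmax⟩ := exists_isOptimal (h := h) (P := P) (τ := τ)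
    (S := {Q | IsAdmissible h P τ Q}) (f := fun Q => innerObjective h (leastSlack h Q) Q)
    (fun Q hQ => hQ) (isClosed_setOf_isAdmissible_gram h P τ)
    (continuous_innerObjective_gram continuous_id hslack fun A =>
      one_le_leastSlack (posSemidef_gram A).2.1 (posSemidef_gram A).2.2) ⟨y.1, hy.1⟩
  refine ⟨(Q, leastSlack h Q), leastSlack_mem_srmFeasible hQ, fun z hz => ?_⟩
  have hz1 : IsAdmissible h P τ z.1 := hz.1
  rw [srmObjective_le_iff hz (leastSlack_mem_srmFeasible hQ)]
  exact (innerObjective_anti (one_le_leastSlack hz1.psd_Qa hz1.psd_Qc) (leastSlack_le hz)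
    hz1.psd_Qa hz1.psd_Qc).trans (hmax z.1 hz1)

/-- Scalar comparison behind the degraded case: `s` is the gain advantage of receiver `0`, `A` and
`C` the noise and confidential powers at the eavesdropper, `δ` additional confidential power. -/
lemma degraded_comparison {s A C α δ : ℝ} (hs : 0 ≤ s) (hA : 0 ≤ A) (hC : 0 ≤ C) (hδ : 0 ≤ δ)
    (hα : 1 ≤ α) (hC' : C ≤ (α - 1) * (1 + A))
    (hpos : 1 < (1 + s * (C + A)) / (α * (1 + s * A)))
    (hle : (1 + s * (C + A + δ)) / (1 + (C + A + δ)) ≤ (1 + s * (C + A)) / (α * (1 + s * A))) :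
    A = 0 ∧ δ = 0 := by
  have hsA : 0 ≤ s * A := mul_nonneg hs hA
  have hα0 : 0 < α := by linarith
  rw [lt_div_iff₀ (by positivity), one_mul] at hpos
  have hαA : 1 + A + C ≤ α * (1 + A) := by linarith
  have h1 : (1 + A + C) * (1 + s * A) ≤ α * (1 + s * A) * (1 + A) := by
    nlinarith [mul_le_mul_of_nonneg_right hαA (by linarith : 0 ≤ 1 + s * A)]
  -- `C * (s - 1)` is exactly `(1 + s(C + A))(1 + A) - (1 + A + C)(1 + sA)`.
  have h2 : 0 < C * (s - 1) := by
    nlinarith [mul_lt_mul_of_pos_right hpos (by linarith : 0 < 1 + A)]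
  have hs1 : 1 < s := by
    by_contra! hs1
    nlinarith [mul_nonneg hC (sub_nonneg.2 hs1)]
  -- Replaces `α` by its least possible value `(1 + A + C) / (1 + A)`.
  have hle2 : (1 + s * (C + A)) / (α * (1 + s * A))
      ≤ (1 + s * (C + A)) * (1 + A) / ((1 + A + C) * (1 + s * A)) := by
    have := mul_nonneg hs (add_nonneg hC hA)
    rw [div_le_div_iff₀ (by positivity) (by positivity)]
    nlinarith [mul_le_mul_of_nonneg_left h1 (by linarith : 0 ≤ 1 + s * (C + A))]
  have hle3 := hle.trans hle2
  rw [div_le_div_iff₀ (by positivity) (by positivity)] at hle3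
  have key : (s - 1) * ((1 + (C + A)) * (1 + s * (C + A)) * A
      + δ * ((1 + s * (C + A)) * A + (1 + s * A))) ≤ 0 := by linarith
  have hT : 0 ≤ s * (C + A) := mul_nonneg hs (add_nonneg hC hA)
  have key' := nonpos_of_mul_nonpos_right key (sub_pos.2 hs1)
  have hAnn : 0 ≤ (1 + (C + A)) * (1 + s * (C + A)) * A := by positivity
  have hδnn : 0 ≤ δ * ((1 + s * (C + A)) * A + (1 + s * A)) := by positivity
  have hA0 : (1 + (C + A)) * (1 + s * (C + A)) * A = 0 := by linarith
  have hδ0 : δ * ((1 + s * (C + A)) * A + (1 + s * A)) = 0 := by linarith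
  exact ⟨(mul_eq_zero.1 hA0).resolve_left (by positivity),
    (mul_eq_zero.1 hδ0).resolve_right (by positivity)⟩

/-- For dependent channels and positive secrecy rate, an optimal solution uses the whole power
budget and its artificial noise does not reach the receivers. -/
lemma degraded_of_isOptimal_srm (hτ : 0 < τ) {c : ℂ} (hc : h 0 = c • h 1)
    {x : Covariances n × ℝ} (hx : IsOptimal (srmFeasible h P τ) (srmObjective h) x)
    (hpos : 0 < srmObjective h x) :
    rxPower (h 1) x.1.Qa = 0 ∧ P ≤ x.1.Q0.trace.re + x.1.Qa.trace.re + x.1.Qc.trace.re := by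
  obtain ⟨Q, α⟩ := x
  have ht := sinrThreshold_pos hτ
  obtain ⟨hα, hQ⟩ := mem_srmFeasible_iff.1 hx.1
  obtain ⟨⟨hm, htr, hp0, hpa, hpc⟩, hs⟩ :=
    (mem_innerFeasible_iff.trans (and_congr_left' isAdmissible_iff)).1 hQ
  simp only at hα hm htr hp0 hpa hpc hs ⊢
  have hrx : ∀ M, rxPower (h 0) M = ‖c‖ ^ 2 * rxPower (h 1) M := by
    intro M; rw [hc, rxPower_smul_left]
  have ha := rxPower_nonneg (h 1) hpa
  have hcc := rxPower_nonneg (h 1) hpc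
  have hval : 1 < innerObjective h α Q := by
    have h1 := innerObjective_pos (h := h) hα hpa hpc
    exact (Real.logb_pos_iff one_lt_two h1).1 hpos
  have hval' := hval
  rw [innerObjective_eq, hrx, hrx, ← mul_add] at hval'
  set R := rankOne (h 1) with hRdef
  have hR : R.PosSemidef := rankOne_posSemidef _
  have hR0 : 0 < rxPower (h 1) R := by
    have hne : h 1 ≠ 0 := hQ.1.channel_ne_zero hτ 1
    rw [hRdef, rxPower_rankOne]
    have : h 1 ⬝ᵥ star (h 1) ≠ 0 := by rwa [Ne, dotProduct_self_star_eq_zero]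
    positivity
  have main : ∀ ε : ℝ, 0 ≤ ε →
      ε * ((1 + sinrThreshold τ) * R.trace.re)
        ≤ P - (Q.Q0.trace.re + Q.Qa.trace.re + Q.Qc.trace.re) →
      rxPower (h 1) Q.Qa = 0 ∧ ε * rxPower (h 1) R = 0 := by
    intro ε hε hεle
    -- All noise becomes confidential signal, leaving the multicast interference and the power
    -- unchanged; `ε` spends the spare budget on top.
    set Q' : Covariances n :=
      ⟨Q.Q0 + (sinrThreshold τ * ε) • R, 0, Q.Qc + Q.Qa + ε • R⟩ with hQ'
    have hadm : IsAdmissible h P τ Q' := by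
      rw [isAdmissible_iff]
      refine ⟨fun k => ?_, ?_, hp0.add (hR.smul (mul_nonneg ht.le hε)), PosSemidef.zero,
        (hpc.add hpa).add (hR.smul hε)⟩
      · simp only [hQ', rxPower_add, rxPower_real_smul, rxPower_zero]
        linarith [hm k]
      · simp only [hQ', trace_add, trace_smul, Complex.add_re, Complex.real_smul,
          Complex.re_ofReal_mul, trace_zero, Complex.zero_re]
        linarith
    have hmem := leastSlack_mem_srmFeasible hadm
    have hle := (srmObjective_le_iff hmem hx.1).1 (hx.2 _ hmem)
    rw [innerObjective_eq, innerObjective_eq] at hle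
    simp only [leastSlack, hQ', rxPower_add, rxPower_real_smul, rxPower_zero, hrx, add_zero,
      mul_zero, div_one, mul_one, ← mul_add] at hle
    exact degraded_comparison (by positivity) ha hcc (mul_nonneg hε hR0.le) hα hs hval'
      hle
  -- `ε = 0` already kills the received noise; a positive `ε` is available only if budget is left,
  -- and then it contradicts optimality.
  refine ⟨(main 0 le_rfl (by linarith)).1, ?_⟩
  by_contra! hlt
  obtain ⟨ε, hε, hεle⟩ := exists_pos_mul_le (sub_pos.2 hlt)
    (mul_nonneg (by linarith : (0 : ℝ) ≤ 1 + sinrThreshold τ) (trace_re_nonneg hR))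
  exact (mul_pos hε hR0).ne' (main ε hε.le hεle).2

/-- All optimal solutions with positive secrecy rate have low rank. -/
lemma rank_of_isOptimal_srm (hτ : 0 < τ) {x : Covariances n × ℝ}
    (hx : IsOptimal (srmFeasible h P τ) (srmObjective h) x) (hpos : 0 < srmObjective h x) :
    (h 0 ⬝ᵥ star (h 1) ≠ 0 → x.1.Q0.rank = 1) ∧ x.1.Qa.rank ≤ 1 := by
  have hα := (mem_srmFeasible_iff.1 hx.1).1
  have hin := isOptimal_inner_of_isOptimal_srm hx
  by_cases hli : LinearIndependent ℂ ![h 0, h 1]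
  · exact rank_of_isOptimal_inner hτ hα hli hin
  have hadm := hin.1.1
  have h1 := hadm.channel_ne_zero hτ 1
  have h0 := hadm.channel_ne_zero hτ 0
  obtain ⟨c, hc⟩ : ∃ c : ℂ, h 0 = c • h 1 := by
    have hli' : ¬ LinearIndependent ℂ ![h 1, h 0] := fun H => hli <| by
      rw [LinearIndependent.pair_iff] at H ⊢
      intro s t hst
      exact (H t s (by rw [add_comm]; exact hst)).symm
    rw [LinearIndependent.pair_iff' h1] at hli'
    push Not at hli'
    obtain ⟨c, hc⟩ := hli'
    exact ⟨c, hc.symm⟩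
  have full : ∀ Q, Improves h x.1 Q → P ≤ Q.Q0.trace.re + Q.Qa.trace.re + Q.Qc.trace.re := by
    intro Q hQ
    have hopt := isOptimal_srm_of_isOptimal_inner hx (hQ.isOptimal hτ hα hin)
    exact (degraded_of_isOptimal_srm hτ hc hopt (hpos.trans_le (hopt.2 x hx.1))).2
  have hrx : ∀ M, rxPower (h 0) M = ‖c‖ ^ 2 * rxPower (h 1) M := by
    intro M; rw [hc, rxPower_smul_left]
  have hA := (degraded_of_isOptimal_srm hτ hc hx hpos).1
  have htr := hadm.trace_add_le
  constructor
  · intro hne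
    obtain ⟨R, hp, -, hr0, hr1, ht, hst⟩ := exists_rank_le_one h0 h1 hadm.psd_Q0
    have hP := full ⟨R, x.1.Qa, x.1.Qc⟩
      ⟨hp, hadm.psd_Qa, Fin.forall_fin_two.2 ⟨hr0, hr1⟩, le_rfl, rfl, rfl, by simpa using ht⟩
    simp only at hP
    exact rank_eq_one_of_rxPower_pos (hst hne (by linarith)) (hadm.rxPower_Q0_pos hτ 0)
  -- Noise heard by neither receiver can be deleted. The result is still optimal, so it spends all
  -- of `P`, leaving trace zero for `Qa`.
  · have hP := full ⟨x.1.Q0, 0, x.1.Qc⟩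
      ⟨hadm.psd_Q0, PosSemidef.zero, fun _ => rfl, by rw [hrx, hrx, hA, rxPower_zero],
        by rw [hA, rxPower_zero], rfl, by simpa using trace_re_nonneg hadm.psd_Qa⟩
    simp only [trace_zero, Complex.zero_re] at hP
    rw [eq_zero_of_trace_re_nonpos hadm.psd_Qa (by linarith), Matrix.rank_zero]
    exact zero_le_one

lemma linearIndependent_pair (hh : LinearIndependent ℂ h) : LinearIndependent ℂ ![h 0, h 1] := by
  convert hh
  ext i : 1
  fin_cases i <;> rfl

end SecrecyRate

end ServiceIntegration

end

theorem proposition2 {n : ℕ} (h : Fin (1 + 1) → Fin n → ℂ) (P τ : ℝ) (hτ : 0 < τ) :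
    -- the inner problem, for every fixed value of the slack variable
    (∀ α : ℝ, 1 ≤ α →
      ((ServiceIntegration.innerFeasible h P τ α).Nonempty →
        ∃ Q, ServiceIntegration.IsOptimal (ServiceIntegration.innerFeasible h P τ α)
            (ServiceIntegration.innerObjective h α) Q ∧
          Q.Q0.rank = 1 ∧ Q.Qa.rank ≤ 1) ∧
      (LinearIndependent ℂ h →
        ∀ Q, ServiceIntegration.IsOptimal (ServiceIntegration.innerFeasible h P τ α)
            (ServiceIntegration.innerObjective h α) Q →
          (h 0 ⬝ᵥ star (h 1) ≠ 0 → Q.Q0.rank = 1) ∧ Q.Qa.rank ≤ 1)) ∧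
    -- the secrecy rate maximization problem itself
    ((ServiceIntegration.srmFeasible h P τ).Nonempty →
      ∃ x, ServiceIntegration.IsOptimal (ServiceIntegration.srmFeasible h P τ)
          (ServiceIntegration.srmObjective h) x ∧
        x.1.Q0.rank = 1 ∧ x.1.Qa.rank ≤ 1) ∧
    (∀ x, ServiceIntegration.IsOptimal (ServiceIntegration.srmFeasible h P τ)
          (ServiceIntegration.srmObjective h) x →
      0 < ServiceIntegration.srmObjective h x →
      (h 0 ⬝ᵥ star (h 1) ≠ 0 → x.1.Q0.rank = 1) ∧ x.1.Qa.rank ≤ 1) := by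
  refine ⟨fun α hα => ⟨fun hne => ?_, fun hli Q hQ => ?_⟩, fun hne => ?_, fun x hx hpos => ?_⟩
  · obtain ⟨Q, hQ⟩ := ServiceIntegration.exists_isOptimal_inner hα hne
    exact ServiceIntegration.exists_rank_le_one_isOptimal hτ hα hQ
  · exact ServiceIntegration.rank_of_isOptimal_inner hτ hα
      (ServiceIntegration.linearIndependent_pair hli) hQ
  · obtain ⟨x, hx⟩ := ServiceIntegration.exists_isOptimal_srm hne
    obtain ⟨Q, hQ, hr⟩ := ServiceIntegration.exists_rank_le_one_isOptimal hτ
      (ServiceIntegration.mem_srmFeasible_iff.1 hx.1).1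
      (ServiceIntegration.isOptimal_inner_of_isOptimal_srm hx)
    exact ⟨(Q, x.2), ServiceIntegration.isOptimal_srm_of_isOptimal_inner hx hQ, hr⟩
  · exact ServiceIntegration.rank_of_isOptimal_srm hτ hx hpos
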